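/- For a square complex matrix $M$ with singular values $m_j$ let $\|M\|_2=(\sum_j m_j^2)^{1/2}$ (Schatten 2-norm, i.e. Hilbert–Schmidt norm). For unitary $d\times d$ matrices $U,V$ ($d\ge 1$) let $$\tilde\epsilon_2(U,V)=\min_{\phi\in\mathbb R}\|U-e^{i\phi}V\|_2,\qquad C_{HST}(U,V)=1-\frac1{d^2}\bigl|\operatorname{Tr}(UV^\dagger)\bigr|^2 .$$ For unitaries $U,V$ on $n\ge 1$ qubits ($d=2^n$) let $$C_{LHST}(U,V)=1-\frac1n\sum_{j=1}^nF_e^{(j)},\qquad F_e^{(j)}=\operatorname{Tr}\bigl(|\Phi^+\rangle\langle\Phi^+|\,(\mathcal E_j\otimes\mathcal I)(|\Phi^+\rangle\langle\Phi^+|)\bigr),$$ where $|\Phi^+\rangle=(|00\rangle+|11\rangle)/\sqrt2$ and $\mathcal E_j$ is the one-qubit channel $\mathcal E_j(\rho)=\operatorname{Tr}_{\bar j}\bigl(UV^\dagger(\rho_j\otimes \mathbb 1_{\bar j}/2^{n-1})VU^\dagger\bigr)$, with $\rho$ placed on qubit $j$ and $\bar j$ the set of the other $n-1$ qubits. (1)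 For all $d\ge1$ and all unitary $d\times d$ matrices $U_1,U_2$, the minimum defining $\tilde\epsilon_2(U_1,U_2)$ is attained, $$\tilde\epsilon_2(U_1,U_2)=\sqrt{2d\bigl(1-\sqrt{1-C_{HST}(U_1,U_2)}\bigr)},$$ and for every integer $N\ge1$ $$1-\sqrt{1-C_{HST}(U_1^N,U_2^N)}\le N^2\bigl(1-\sqrt{1-C_{HST}(U_1,U_2)}\bigr).$$ (2) For all $n\ge1$ and all unitaries $U,V$ on $n$ qubits, $C_{LHST}(U,V)\le C_{HST}(U,V)\le n\,C_{LHST}(U,V)$; and if $n\,C_{LHST}(U,V)\le1$, then for every integer $N\ge1$ $$1-\sqrt{1-C_{LHST}(U^N,V^N)}\le N^2\bigl(1-\sqrt{1-n\,C_{LHST}(U,V)}\bigr).$$ (3) When $n\,C_{LHST}(U,V)$ is small, $C_{LHST}(U^N,V^N)\lesssim nN^2C_{LHST}(U,V)$, in the following sense: for every $\varepsilon>0$ there is $\delta>0$, independent of $n$, $N$, $U$, $V$, such that for all $n,N\ge1$ and all unitaries $U,V$ on $n$ qubits with $n\,C_{LHST}(U,V)\le\delta$, $$C_{LHST}(U^N,V^N)\le(1+\varepsilon)\,nN^2\,C_{LHST}(U,V).$$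 -/

import Mathlib

open scoped Matrix Kronecker

noncomputable section

/-- The Schatten `p`-norm `(∑ⱼ mⱼ ^ p) ^ (1 / p)` of a square complex matrix `M`, where the singular
values `mⱼ` are the square roots of the eigenvalues of `Mᴴ * M`. -/
def schattenNorm {ι : Type*} [Fintype ι] [DecidableEq ι] (p : ℝ) (M : Matrix ι ι ℂ) : ℝ :=
  (∑ j, Real.sqrt ((Matrix.isHermitian_conjTranspose_mul_self M).eigenvalues j) ^ p) ^ (1 / p)

/-- The Hilbert–Schmidt distance of `U₁` and `exp (i φ) U₂`, as a function of the phase `φ`. -/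
def phaseDist {ι : Type*} [Fintype ι] [DecidableEq ι] (U₁ U₂ : Matrix ι ι ℂ) (φ : ℝ) : ℝ :=
  schattenNorm 2 (U₁ - Complex.exp (Complex.I * φ) • U₂)

/-- The phase-minimised Hilbert–Schmidt distance `min_φ ‖U₁ - exp (i φ) U₂‖₂`. -/
def epsTilde {ι : Type*} [Fintype ι] [DecidableEq ι] (U₁ U₂ : Matrix ι ι ℂ) : ℝ :=
  ⨅ φ : ℝ, phaseDist U₁ U₂ φ

/-- The Hilbert–Schmidt test cost `1 - |Tr (U V†)|² / d²`, with `d` the dimension. -/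
def costHST {ι : Type*} [Fintype ι] (U V : Matrix ι ι ℂ) : ℝ :=
  1 - 1 / (Fintype.card ι : ℝ) ^ 2 * ‖(U * Vᴴ).trace‖ ^ 2

/-- Computational basis labels of `n` qubits; an operator on `n` qubits is a matrix
indexed by them, of size `2 ^ n`. -/
abbrev Qubits (n : ℕ) : Type := Fin n → Fin 2

/-- Basis labels of all qubits except the `j`-th one. -/
abbrev OtherQubits {n : ℕ} (j : Fin n) : Type := {k : Fin n // k ≠ j} → Fin 2

/-- The factorisation of the `n`-qubit basis into the `j`-th qubit and all the others. -/
abbrev splitQubit {n : ℕ} (j : Fin n) : Qubits n ≃ Fin 2 × OtherQubits j :=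
  Equiv.funSplitAt j (Fin 2)

/-- The `n`-qubit operator `ρ ⊗ σ`, with `ρ` acting on qubit `j` and `σ` on all the others. -/
def placeAt {n : ℕ} (j : Fin n) (ρ : Matrix (Fin 2) (Fin 2) ℂ)
    (σ : Matrix (OtherQubits j) (OtherQubits j) ℂ) : Matrix (Qubits n) (Qubits n) ℂ :=
  (ρ ⊗ₖ σ).submatrix (splitQubit j) (splitQubit j)

/-- The partial trace over all qubits except the `j`-th one. -/
def traceOthers {n : ℕ} (j : Fin n) (M : Matrix (Qubits n) (Qubits n) ℂ) :
    Matrix (Fin 2) (Fin 2) ℂ :=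
  Matrix.of fun a b => ∑ z : OtherQubits j, M ((splitQubit j).symm (a, z)) ((splitQubit j).symm (b, z))

/-- The maximally mixed state `1 / 2 ^ (n - 1)` of all qubits except the `j`-th one. -/
def maxMixedOthers {n : ℕ} (j : Fin n) : Matrix (OtherQubits j) (OtherQubits j) ℂ :=
  (1 / (2 : ℂ) ^ (n - 1)) • (1 : Matrix (OtherQubits j) (OtherQubits j) ℂ)

/-- The one-qubit channel
`ρ ↦ Tr_{all but j} (U V† (ρ_j ⊗ 1 / 2 ^ (n - 1)) V U†)`. -/
def localChannel {n : ℕ} (U V : Matrix (Qubits n) (Qubits n) ℂ) (j : Fin n) :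
    Matrix (Fin 2) (Fin 2) ℂ →ₗ[ℂ] Matrix (Fin 2) (Fin 2) ℂ where
  toFun ρ := traceOthers j (U * Vᴴ * placeAt j ρ (maxMixedOthers j) * (V * Uᴴ))
  map_add' ρ σ := by
    have h : placeAt j (ρ + σ) (maxMixedOthers j)
        = placeAt j ρ (maxMixedOthers j) + placeAt j σ (maxMixedOthers j) := by
      simp [placeAt, Matrix.add_kronecker]
      rfl
    rw [h, Matrix.mul_add, Matrix.add_mul]
    ext a b
    simp [traceOthers, Finset.sum_add_distrib]
  map_smul' c ρ := by
    have h : placeAt j (c • ρ) (maxMixedOthers j) = c • placeAt j ρ (maxMixedOthers j) := by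
      simp [placeAt, Matrix.smul_kronecker]
      rfl
    rw [h, Matrix.mul_smul, Matrix.smul_mul]
    ext a b
    simp [traceOthers, Finset.mul_sum]

/-- The map `Φ ⊗ id` on operators on two qubits `A B`, with `Φ` acting on `A`
(the first component of an index). -/
def tensorId (Φ : Matrix (Fin 2) (Fin 2) ℂ →ₗ[ℂ] Matrix (Fin 2) (Fin 2) ℂ)
    (X : Matrix (Fin 2 × Fin 2) (Fin 2 × Fin 2) ℂ) : Matrix (Fin 2 × Fin 2) (Fin 2 × Fin 2) ℂ :=
  Matrix.of fun p q => Φ (Matrix.of fun a a' => X (a, p.2) (a', q.2)) p.1 q.1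

/-- The Bell vector `(|00⟩ + |11⟩) / √2`. -/
def bellVec : Fin 2 × Fin 2 → ℂ :=
  fun p => if p.1 = p.2 then 1 / (Real.sqrt 2 : ℂ) else 0

/-- The projector onto the Bell vector. -/
def bellProj : Matrix (Fin 2 × Fin 2) (Fin 2 × Fin 2) ℂ :=
  Matrix.vecMulVec bellVec (star bellVec)

/-- The entanglement fidelity of the `j`-th local channel (a real number, being the overlap
of two positive semidefinite operators). -/
def entFidelity {n : ℕ} (U V : Matrix (Qubits n) (Qubits n) ℂ) (j : Fin n) : ℝ :=
  (bellProj * tensorId (localChannel U V j) bellProj).trace.re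

/-- The local Hilbert–Schmidt test cost. -/
def costLHST {n : ℕ} (U V : Matrix (Qubits n) (Qubits n) ℂ) : ℝ :=
  1 - 1 / (n : ℝ) * ∑ j, entFidelity U V j

end

/-! Global cost: for unitaries and a unit phase `c`, `‖U - c V‖² = 2d - 2 Re (c̄ Tr UV†)` is
smallest when `c` has the argument of the trace, and `√(1 - C_HST) = |Tr UV†| / d`. Telescoping
bounds `‖U^N - c^N V^N‖` by `N ‖U - c V‖`; squaring gives the factor `N²`.

Local cost: on operators with the Hilbert–Schmidt inner product, the maps `M ↦ (1/2) ⊗ Tr_j M` are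
commuting orthogonal projections `P_j`. With `W = UV†`, fidelity `j` is `‖P_j W‖² / 2^n`
(`entFidelity_eq`), while the product of all `P_j` projects onto the scalars, leaving squared norm
`|Tr W|² / 2^n`. Cauchy–Schwarz against the identity gives `C_LHST ≤ C_HST`; a union bound over the
`P_j` gives `C_HST ≤ n C_LHST`. The bounds for powers pass from local to global cost, apply the `N²`
bound, and return. -/

/-! ### Phase-minimised distance and the global cost -/

section GlobalCost

open scoped Matrix.Norms.Frobenius ComplexOrder

variable {ι : Type*} [Fintype ι] [DecidableEq ι]

lemma frobenius_norm_sq_eq_re_trace (M : Matrix ι ι ℂ) : ‖M‖ ^ 2 = (Mᴴ * M).trace.re := by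
  rw [Matrix.frobenius_norm_def, ← Real.sqrt_eq_rpow, Real.sq_sqrt (by positivity),
    Finset.sum_comm, Matrix.trace, Complex.re_sum]
  refine Finset.sum_congr rfl fun i _ => ?_
  rw [Matrix.diag_apply, Matrix.mul_apply, Complex.re_sum]
  refine Finset.sum_congr rfl fun j _ => ?_
  rw [Matrix.conjTranspose_apply, Real.rpow_two, RCLike.star_def, ← Complex.normSq_eq_conj_mul_self,
    Complex.ofReal_re, Complex.normSq_eq_norm_sq]

lemma schattenNorm_two (M : Matrix ι ι ℂ) : schattenNorm 2 M = ‖M‖ := by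
  have h : ∑ j, Real.sqrt ((Matrix.isHermitian_conjTranspose_mul_self M).eigenvalues j) ^ (2 : ℝ)
      = ‖M‖ ^ 2 := by
    rw [frobenius_norm_sq_eq_re_trace,
      (Matrix.isHermitian_conjTranspose_mul_self M).trace_eq_sum_eigenvalues, Complex.re_sum]
    refine Finset.sum_congr rfl fun j _ => ?_
    rw [Real.rpow_two, Real.sq_sqrt
      ((Matrix.posSemidef_conjTranspose_mul_self M).eigenvalues_nonneg j)]
    simp
  rw [schattenNorm, h, ← Real.sqrt_eq_rpow, Real.sqrt_sq (norm_nonneg _)]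

lemma frobenius_norm_unitary_mul {U : Matrix ι ι ℂ} (hU : U ∈ Matrix.unitaryGroup ι ℂ)
    (M : Matrix ι ι ℂ) : ‖U * M‖ = ‖M‖ := by
  rw [← sq_eq_sq₀ (norm_nonneg _) (norm_nonneg _), frobenius_norm_sq_eq_re_trace,
    frobenius_norm_sq_eq_re_trace, Matrix.conjTranspose_mul, Matrix.mul_assoc,
    ← Matrix.mul_assoc Uᴴ, ← Matrix.star_eq_conjTranspose U, Matrix.mem_unitaryGroup_iff'.1 hU,
    Matrix.one_mul]

lemma frobenius_norm_mul_unitary {U : Matrix ι ι ℂ} (hU : U ∈ Matrix.unitaryGroup ι ℂ)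
    (M : Matrix ι ι ℂ) : ‖M * U‖ = ‖M‖ := by
  rw [← Matrix.frobenius_norm_conjTranspose, Matrix.conjTranspose_mul,
    ← Matrix.star_eq_conjTranspose U, frobenius_norm_unitary_mul (Unitary.star_mem hU),
    Matrix.frobenius_norm_conjTranspose]

/-- Telescoping: each extra factor adds one copy of `U - c V`, multiplied by unitaries and a unit
phase, which preserve the norm. -/
lemma norm_pow_sub_pow_le {U V : Matrix ι ι ℂ} (hU : U ∈ Matrix.unitaryGroup ι ℂ)
    (hV : V ∈ Matrix.unitaryGroup ι ℂ) (c : ℂ) (hc : ‖c‖ = 1) (N : ℕ) :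
    ‖U ^ N - c ^ N • V ^ N‖ ≤ N * ‖U - c • V‖ := by
  induction N with
  | zero => simp
  | succ N ih =>
    have h : U ^ (N + 1) - c ^ (N + 1) • V ^ (N + 1)
        = U * (U ^ N - c ^ N • V ^ N) + c ^ N • ((U - c • V) * V ^ N) := by
      rw [Matrix.mul_sub, Matrix.sub_mul, Matrix.mul_smul, Matrix.smul_mul, smul_sub, smul_smul,
        ← pow_succ, ← pow_succ', ← pow_succ']
      abel
    rw [h]
    refine (norm_add_le _ _).trans ?_
    rw [frobenius_norm_unitary_mul hU, norm_smul, frobenius_norm_mul_unitary (pow_mem hV N),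
      norm_pow, hc, one_pow, one_mul]
    push_cast
    linarith

lemma frobenius_norm_unitary_sub_smul_sq {U V : Matrix ι ι ℂ} (hU : U ∈ Matrix.unitaryGroup ι ℂ)
    (hV : V ∈ Matrix.unitaryGroup ι ℂ) (c : ℂ) (hc : ‖c‖ = 1) :
    ‖U - c • V‖ ^ 2
      = 2 * (Fintype.card ι : ℝ) - 2 * (star c * (U * Vᴴ).trace).re := by
  have hU' : Uᴴ * U = 1 := Matrix.mem_unitaryGroup_iff'.1 hU
  have hV' : Vᴴ * V = 1 := Matrix.mem_unitaryGroup_iff'.1 hV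
  have hcc : star c * c = 1 := by
    rw [RCLike.star_def, ← Complex.normSq_eq_conj_mul_self, Complex.normSq_eq_norm_sq, hc]
    simp
  have h1 : (Uᴴ * V).trace = star (U * Vᴴ).trace := by
    rw [← Matrix.trace_conjTranspose, Matrix.conjTranspose_mul, Matrix.conjTranspose_conjTranspose,
      Matrix.trace_mul_comm]
  have h2 : (Vᴴ * U).trace = (U * Vᴴ).trace := Matrix.trace_mul_comm _ _
  have h : ((U - c • V)ᴴ * (U - c • V)).trace
      = 2 * (Fintype.card ι : ℂ) - (star c * (U * Vᴴ).trace + star (star c * (U * Vᴴ).trace)) := by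
    rw [Matrix.conjTranspose_sub, Matrix.conjTranspose_smul, Matrix.sub_mul, Matrix.mul_sub,
      Matrix.mul_sub, Matrix.smul_mul, Matrix.mul_smul, Matrix.smul_mul, Matrix.mul_smul, smul_smul,
      hU', hV', hcc]
    simp only [Matrix.trace_sub, Matrix.trace_smul, h1, h2, Matrix.trace_one, smul_eq_mul,
      star_mul, star_star]
    ring
  rw [frobenius_norm_sq_eq_re_trace, h]
  simp only [Complex.sub_re, Complex.add_re, RCLike.star_def, Complex.conj_re]
  norm_num
  ring

lemma phaseDist_eq_frobenius_norm (U V : Matrix ι ι ℂ) (φ : ℝ) :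
    phaseDist U V φ = ‖U - Complex.exp (Complex.I * φ) • V‖ := schattenNorm_two _

lemma norm_exp_I_mul (φ : ℝ) : ‖Complex.exp (Complex.I * φ)‖ = 1 := by
  rw [mul_comm, Complex.norm_exp_ofReal_mul_I]

lemma le_phaseDist_sq {U V : Matrix ι ι ℂ} (hU : U ∈ Matrix.unitaryGroup ι ℂ)
    (hV : V ∈ Matrix.unitaryGroup ι ℂ) (φ : ℝ) :
    2 * (Fintype.card ι : ℝ) - 2 * ‖(U * Vᴴ).trace‖ ≤ phaseDist U V φ ^ 2 := by
  rw [phaseDist_eq_frobenius_norm, frobenius_norm_unitary_sub_smul_sq hU hV _ (norm_exp_I_mul φ)]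
  have := Complex.re_le_norm (star (Complex.exp (Complex.I * φ)) * (U * Vᴴ).trace)
  rw [norm_mul, norm_star, norm_exp_I_mul, one_mul] at this
  linarith

lemma phaseDist_arg_sq {U V : Matrix ι ι ℂ} (hU : U ∈ Matrix.unitaryGroup ι ℂ)
    (hV : V ∈ Matrix.unitaryGroup ι ℂ) :
    phaseDist U V (U * Vᴴ).trace.arg ^ 2
      = 2 * (Fintype.card ι : ℝ) - 2 * ‖(U * Vᴴ).trace‖ := by
  rw [phaseDist_eq_frobenius_norm, frobenius_norm_unitary_sub_smul_sq hU hV _ (norm_exp_I_mul _)]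
  have h : star (Complex.exp (Complex.I * (U * Vᴴ).trace.arg)) * (U * Vᴴ).trace
      = (‖(U * Vᴴ).trace‖ : ℂ) := by
    nth_rw 2 [← Complex.norm_mul_exp_arg_mul_I (U * Vᴴ).trace]
    rw [mul_comm Complex.I, mul_left_comm, RCLike.star_def, ← Complex.normSq_eq_conj_mul_self,
      Complex.normSq_eq_norm_sq, Complex.norm_exp_ofReal_mul_I]
    simp
  rw [h, Complex.ofReal_re]

lemma phaseDist_nonneg (U V : Matrix ι ι ℂ) (φ : ℝ) : 0 ≤ phaseDist U V φ := by
  rw [phaseDist_eq_frobenius_norm]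
  exact norm_nonneg _

lemma isLeast_phaseDist {U V : Matrix ι ι ℂ} (hU : U ∈ Matrix.unitaryGroup ι ℂ)
    (hV : V ∈ Matrix.unitaryGroup ι ℂ) :
    IsLeast (Set.range (phaseDist U V)) (phaseDist U V (U * Vᴴ).trace.arg) := by
  refine ⟨⟨_, rfl⟩, ?_⟩
  rintro _ ⟨φ, rfl⟩
  rw [← sq_le_sq₀ (phaseDist_nonneg _ _ _) (phaseDist_nonneg _ _ _), phaseDist_arg_sq hU hV]
  exact le_phaseDist_sq hU hV φ

/-- The minimal squared distance `2d - 2|Tr UV†|` is nonnegative. -/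
lemma norm_trace_le_card {U V : Matrix ι ι ℂ} (hU : U ∈ Matrix.unitaryGroup ι ℂ)
    (hV : V ∈ Matrix.unitaryGroup ι ℂ) : ‖(U * Vᴴ).trace‖ ≤ Fintype.card ι := by
  have := phaseDist_arg_sq hU hV
  have := sq_nonneg (phaseDist U V (U * Vᴴ).trace.arg)
  linarith

omit [DecidableEq ι] in
lemma sqrt_one_sub_costHST (U V : Matrix ι ι ℂ) :
    Real.sqrt (1 - costHST U V) = ‖(U * Vᴴ).trace‖ / Fintype.card ι := by
  have h : 1 - costHST U V = (‖(U * Vᴴ).trace‖ / Fintype.card ι) ^ 2 := by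
    rw [costHST, div_pow]
    ring
  rw [h, Real.sqrt_sq (by positivity)]

omit [DecidableEq ι] in
lemma costHST_le_one (U V : Matrix ι ι ℂ) : costHST U V ≤ 1 := by
  rw [costHST]
  have : 0 ≤ 1 / (Fintype.card ι : ℝ) ^ 2 * ‖(U * Vᴴ).trace‖ ^ 2 := by positivity
  linarith

variable [Nonempty ι]

lemma costHST_nonneg {U V : Matrix ι ι ℂ} (hU : U ∈ Matrix.unitaryGroup ι ℂ)
    (hV : V ∈ Matrix.unitaryGroup ι ℂ) : 0 ≤ costHST U V := by
  have hd : (0 : ℝ) < Fintype.card ι := Nat.cast_pos.2 Fintype.card_pos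
  have h := norm_trace_le_card hU hV
  rw [costHST, one_div_mul_eq_div, ← div_pow, sub_nonneg]
  exact pow_le_one₀ (by positivity) ((div_le_one hd).2 h)

lemma phaseDist_arg_sq_eq_costHST {U V : Matrix ι ι ℂ} (hU : U ∈ Matrix.unitaryGroup ι ℂ)
    (hV : V ∈ Matrix.unitaryGroup ι ℂ) :
    phaseDist U V (U * Vᴴ).trace.arg ^ 2
      = 2 * (Fintype.card ι : ℝ) * (1 - Real.sqrt (1 - costHST U V)) := by
  have hd : (0 : ℝ) < Fintype.card ι := Nat.cast_pos.2 Fintype.card_pos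
  rw [phaseDist_arg_sq hU hV, sqrt_one_sub_costHST]
  field_simp

lemma epsTilde_isLeast_and_eq {U V : Matrix ι ι ℂ} (hU : U ∈ Matrix.unitaryGroup ι ℂ)
    (hV : V ∈ Matrix.unitaryGroup ι ℂ) :
    IsLeast (Set.range (phaseDist U V)) (epsTilde U V) ∧
      epsTilde U V
        = Real.sqrt (2 * (Fintype.card ι : ℝ) * (1 - Real.sqrt (1 - costHST U V))) := by
  have h := isLeast_phaseDist hU hV
  have he : epsTilde U V = phaseDist U V (U * Vᴴ).trace.arg := h.csInf_eq
  rw [he, ← phaseDist_arg_sq_eq_costHST hU hV, Real.sqrt_sq (phaseDist_nonneg _ _ _)]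
  exact ⟨h, rfl⟩

lemma one_sub_sqrt_costHST_pow_le {U V : Matrix ι ι ℂ} (hU : U ∈ Matrix.unitaryGroup ι ℂ)
    (hV : V ∈ Matrix.unitaryGroup ι ℂ) (N : ℕ) :
    1 - Real.sqrt (1 - costHST (U ^ N) (V ^ N))
      ≤ (N : ℝ) ^ 2 * (1 - Real.sqrt (1 - costHST U V)) := by
  have hd : (0 : ℝ) < Fintype.card ι := Nat.cast_pos.2 Fintype.card_pos
  have hU' := pow_mem hU N
  have hV' := pow_mem hV N
  set φ := (U * Vᴴ).trace.arg with hφ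
  -- `Nφ` need not be optimal for the powers, but it bounds their minimum from above.
  have h1 := (isLeast_phaseDist hU' hV').2 ⟨(N : ℝ) * φ, rfl⟩
  have h2 : phaseDist (U ^ N) (V ^ N) ((N : ℝ) * φ) ≤ N * phaseDist U V φ := by
    rw [phaseDist_eq_frobenius_norm, phaseDist_eq_frobenius_norm]
    have h := norm_pow_sub_pow_le hU hV _ (norm_exp_I_mul φ) N
    rwa [← Complex.exp_nat_mul, mul_left_comm, ← Complex.ofReal_natCast,
      ← Complex.ofReal_mul] at h
  have h3 := pow_le_pow_left₀ (phaseDist_nonneg _ _ _) (h1.trans h2) 2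
  rw [mul_pow, phaseDist_arg_sq_eq_costHST hU' hV', phaseDist_arg_sq_eq_costHST hU hV,
    mul_left_comm] at h3
  exact le_of_mul_le_mul_left h3 (by positivity)

end GlobalCost

/-! ### Commuting orthogonal projections -/

section Projections

variable {E : Type*} [NormedAddCommGroup E] [InnerProductSpace ℂ E]

lemma LinearMap.IsSymmetricProjection.norm_apply_sq {T : E →ₗ[ℂ] E} (hT : T.IsSymmetricProjection)
    (x : E) : ‖T x‖ ^ 2 = (inner ℂ x (T x)).re := by
  have h : T (T x) = T x := congrArg (fun S : E →ₗ[ℂ] E => S x) hT.isIdempotentElem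
  have h2 := hT.isSymmetric x (T x)
  rw [h] at h2
  rw [← h2]
  exact norm_sq_eq_re_inner (𝕜 := ℂ) _

lemma LinearMap.IsSymmetricProjection.norm_sub_apply_sq {T : E →ₗ[ℂ] E}
    (hT : T.IsSymmetricProjection) (x : E) : ‖x - T x‖ ^ 2 = ‖x‖ ^ 2 - ‖T x‖ ^ 2 := by
  have h := @norm_sub_sq ℂ E _ _ _ x (T x)
  have h2 := hT.norm_apply_sq x
  simp only [RCLike.re_to_complex] at h
  linarith

lemma LinearMap.IsSymmetricProjection.norm_apply_le {T : E →ₗ[ℂ] E}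
    (hT : T.IsSymmetricProjection) (x : E) : ‖T x‖ ≤ ‖x‖ := by
  rw [← sq_le_sq₀ (norm_nonneg _) (norm_nonneg _)]
  have := hT.norm_sub_apply_sq x
  have := sq_nonneg ‖x - T x‖
  linarith

lemma norm_prod_apply_le {κ : Type*} (P : κ → E →ₗ[ℂ] E)
    (hP : ∀ k, (P k).IsSymmetricProjection) (l : List κ) (x : E) :
    ‖(l.map P).prod x‖ ≤ ‖x‖ := by
  induction l with
  | nil => simp
  | cons i l ih =>
    rw [List.map_cons, List.prod_cons, Module.End.mul_apply]
    exact ((hP i).norm_apply_le _).trans ih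

/-- A union bound for commuting orthogonal projections. -/
lemma norm_sq_sub_norm_prod_sq_le_sum {κ : Type*} (P : κ → E →ₗ[ℂ] E)
    (hP : ∀ k, (P k).IsSymmetricProjection) (hc : ∀ i j, Commute (P i) (P j)) (l : List κ) (x : E) :
    ‖x‖ ^ 2 - ‖(l.map P).prod x‖ ^ 2 ≤ (l.map fun k => ‖x‖ ^ 2 - ‖P k x‖ ^ 2).sum := by
  induction l with
  | nil => simp
  | cons i l ih =>
    have hcomm : Commute (P i) (l.map P).prod := by
      refine Commute.list_prod_right _ _ fun S hS => ?_
      obtain ⟨k, -, rfl⟩ := List.mem_map.1 hS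
      exact hc i k
    have hcomm' : P i ((l.map P).prod x) = (l.map P).prod (P i x) :=
      congrArg (fun S : E →ₗ[ℂ] E => S x) hcomm.eq
    rw [List.map_cons, List.map_cons, List.prod_cons, List.sum_cons, Module.End.mul_apply]
    -- By commutation, the norm lost when `P i` acts after the product is that of the product
    -- applied to `x - P i x`; the product is a contraction, so the loss is at most `‖x - P i x‖²`.
    have h1 := (hP i).norm_sub_apply_sq ((l.map P).prod x)
    rw [hcomm', ← map_sub, ← hcomm'] at h1
    have h2 := pow_le_pow_left₀ (norm_nonneg _) (norm_prod_apply_le P hP l (x - P i x)) 2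
    have h3 := (hP i).norm_sub_apply_sq x
    linarith

lemma apply_prod_apply {κ : Type*} (P : κ → E →ₗ[ℂ] E)
    (hP : ∀ k, (P k).IsSymmetricProjection) (hc : ∀ i j, Commute (P i) (P j)) (l : List κ)
    {i : κ} (hi : i ∈ l) (x : E) : P i ((l.map P).prod x) = (l.map P).prod x := by
  induction l with
  | nil => simp at hi
  | cons j l ih =>
    have happ (k : κ) (y : E) : P k (P j y) = P j (P k y) :=
      congrArg (fun S : E →ₗ[ℂ] E => S y) (hc k j).eq
    rw [List.map_cons, List.prod_cons, Module.End.mul_apply]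
    rcases List.mem_cons.1 hi with rfl | hi
    · exact congrArg (fun S : E →ₗ[ℂ] E => S _) (hP i).isIdempotentElem
    · rw [happ, ih hi]

/-- Self-adjointness moves each projection onto the fixed vector `y`. With `y` the identity
operator, this says that the trace survives the product. -/
lemma inner_prod_apply {κ : Type*} (P : κ → E →ₗ[ℂ] E)
    (hP : ∀ k, (P k).IsSymmetricProjection) (l : List κ) (y : E) (hy : ∀ k, P k y = y) (x : E) :
    inner ℂ y ((l.map P).prod x) = inner ℂ y x := by
  induction l with
  | nil => simp
  | cons j l ih =>
    rw [List.map_cons, List.prod_cons, Module.End.mul_apply, ← (hP j).isSymmetric, hy, ih]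

end Projections

/-! ### Local fidelities as projections in operator space -/

section LocalCost

variable {n : ℕ}

lemma splitQubit_symm_eq_update (j : Fin n) (x : Qubits n) (s : Fin 2) :
    (splitQubit j).symm (s, (splitQubit j x).2) = Function.update x j s := by
  rw [Equiv.symm_apply_eq]
  ext k
  · simp [splitQubit, Equiv.funSplitAt, Equiv.piSplitAt]
  · simp [splitQubit, Equiv.funSplitAt, Equiv.piSplitAt, k.2]

/-- The orthogonal projection `M ↦ (1 / 2) ⊗ Tr_j M` on operators on `n` qubits, seen as vectors. -/
noncomputable def depolarize (j : Fin n) : EuclideanSpace ℂ (Qubits n × Qubits n) →ₗ[ℂ]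
    EuclideanSpace ℂ (Qubits n × Qubits n) where
  toFun f := WithLp.toLp 2 fun p => if p.1 j = p.2 j then
    (1 / 2 : ℂ) * ∑ s : Fin 2, f (Function.update p.1 j s, Function.update p.2 j s) else 0
  map_add' f g := by
    ext p
    by_cases h : p.1 j = p.2 j <;> simp [h]
    ring
  map_smul' c f := by
    ext p
    by_cases h : p.1 j = p.2 j <;> simp [h]
    ring

lemma depolarize_apply (j : Fin n) (f : EuclideanSpace ℂ (Qubits n × Qubits n))
    (x y : Qubits n) : depolarize j f (x, y) = if x j = y j then
      (1 / 2 : ℂ) * ∑ s : Fin 2, f (Function.update x j s, Function.update y j s) else 0 := rfl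

lemma depolarize_idem (j : Fin n) : IsIdempotentElem (depolarize j) := by
  refine LinearMap.ext fun f => ?_
  ext ⟨x, y⟩
  rw [Module.End.mul_apply, depolarize_apply, depolarize_apply]
  by_cases h : x j = y j
  · simp only [depolarize_apply, Function.update_self, Function.update_idem, if_true, h,
      Fin.sum_univ_two]
    ring
  · simp [h]

lemma depolarize_commute (i j : Fin n) : Commute (depolarize i) (depolarize j) := by
  rcases eq_or_ne i j with rfl | hij
  · exact Commute.refl _
  refine LinearMap.ext fun f => ?_
  ext ⟨x, y⟩
  rw [Module.End.mul_apply, Module.End.mul_apply]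
  simp only [depolarize_apply, Function.update_of_ne hij, Function.update_of_ne hij.symm]
  by_cases hi : x i = y i <;> by_cases hj : x j = y j <;>
    simp only [hi, hj, if_true, if_false, Finset.sum_const_zero, mul_zero, Fin.sum_univ_two,
      Function.update_comm hij]
  ring

lemma depolarize_apply_symm (j : Fin n) (f : EuclideanSpace ℂ (Qubits n × Qubits n))
    (a b : Fin 2) (z w : OtherQubits j) :
    depolarize j f ((splitQubit j).symm (a, z), (splitQubit j).symm (b, w))
      = if a = b then (1 / 2 : ℂ) *
          ∑ s : Fin 2, f ((splitQubit j).symm (s, z), (splitQubit j).symm (s, w)) else 0 := by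
  have h (a : Fin 2) (z : OtherQubits j) : (splitQubit j).symm (a, z) j = a := by
    simp [splitQubit, Equiv.funSplitAt, Equiv.piSplitAt]
  simp only [depolarize_apply, h, ← splitQubit_symm_eq_update, Equiv.apply_symm_apply]

/-- Pairing with `P_j g` is half the pairing of the partial traces over qubit `j`. This form is
visibly Hermitian and is the one the entanglement fidelity produces. -/
lemma inner_depolarize (j : Fin n) (f g : EuclideanSpace ℂ (Qubits n × Qubits n)) :
    inner ℂ f (depolarize j g) = (1 / 2 : ℂ) * ∑ z : OtherQubits j, ∑ w : OtherQubits j,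
      star (∑ a : Fin 2, f ((splitQubit j).symm (a, z), (splitQubit j).symm (a, w))) *
        ∑ a : Fin 2, g ((splitQubit j).symm (a, z), (splitQubit j).symm (a, w)) := by
  rw [PiLp.inner_apply, ← ((splitQubit j).symm.prodCongr (splitQubit j).symm).sum_comp]
  simp only [Fintype.sum_prod_type, Equiv.prodCongr_apply, Prod.map_apply, depolarize_apply_symm,
    Finset.mul_sum]
  rw [Finset.sum_comm]
  refine Finset.sum_congr rfl fun z _ => ?_
  simp only [Fin.sum_univ_two, ← Finset.sum_add_distrib]
  refine Finset.sum_congr rfl fun w _ => ?_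
  simp
  ring

lemma isSymmetricProjection_depolarize (j : Fin n) : (depolarize j).IsSymmetricProjection := by
  refine ⟨depolarize_idem j, fun f g => ?_⟩
  rw [← inner_conj_symm, inner_depolarize, inner_depolarize, map_mul, map_sum]
  congr 1
  · simp [Complex.conj_ofNat]
  refine Finset.sum_congr rfl fun z _ => ?_
  rw [map_sum]
  refine Finset.sum_congr rfl fun w _ => ?_
  rw [map_mul, RCLike.star_def, Complex.conj_conj, mul_comm]

/-- The entries of an operator on `n` qubits, as a vector. -/
noncomputable def vectorize (M : Matrix (Qubits n) (Qubits n) ℂ) : EuclideanSpace ℂ (Qubits n × Qubits n) :=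
  WithLp.toLp 2 fun p => M p.1 p.2

lemma vectorize_apply (M : Matrix (Qubits n) (Qubits n) ℂ) (x y : Qubits n) :
    vectorize M (x, y) = M x y := rfl

lemma inner_vectorize_one (f : EuclideanSpace ℂ (Qubits n × Qubits n)) :
    inner ℂ (vectorize 1) f = ∑ x, f (x, x) := by
  rw [PiLp.inner_apply, Fintype.sum_prod_type]
  simp [vectorize_apply, Matrix.one_apply, apply_ite]

lemma depolarize_vectorize_one (j : Fin n) : depolarize j (vectorize 1) = vectorize 1 := by
  ext ⟨x, y⟩
  rw [depolarize_apply]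
  simp only [vectorize_apply, Matrix.one_apply]
  by_cases h : x j = y j
  · have h2 (s : Fin 2) : Function.update x j s = Function.update y j s ↔ x = y := by
      refine ⟨fun he => funext fun k => ?_, fun he => by rw [he]⟩
      rcases eq_or_ne k j with rfl | hk
      · exact h
      · simpa [hk] using congrFun he k
    simp only [h, if_true, h2]
    by_cases hxy : x = y <;> simp [hxy]
  · rw [if_neg h, if_neg fun he => h (by rw [he])]

lemma norm_vectorize_sq {M : Matrix (Qubits n) (Qubits n) ℂ}
    (hM : M ∈ Matrix.unitaryGroup (Qubits n) ℂ) : ‖vectorize M‖ ^ 2 = 2 ^ n := by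
  have h : ∀ x, ∑ y, ‖M x y‖ ^ 2 = 1 := fun x => by
    have h1 := congrFun (congrFun (Matrix.mem_unitaryGroup_iff.1 hM) x) x
    rw [Matrix.mul_apply, Matrix.one_apply_eq] at h1
    have h2 := congrArg Complex.re h1
    rw [Complex.re_sum] at h2
    rw [← Complex.one_re, ← h2]
    refine Finset.sum_congr rfl fun y _ => ?_
    rw [Matrix.star_apply, RCLike.star_def, Complex.mul_conj, Complex.ofReal_re,
      Complex.normSq_eq_norm_sq]
  rw [EuclideanSpace.norm_sq_eq, Fintype.sum_prod_type]
  simp [vectorize_apply, h]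

/-- The coordinates of `y` are replaced by those of `x` one at a time. -/
lemma eq_of_update_invariant (h : Qubits n → ℂ)
    (hh : ∀ x j s t, h (Function.update x j s) = h (Function.update x j t)) (x y : Qubits n) :
    h x = h y := by
  have key (S : Finset (Fin n)) : h (S.piecewise x y) = h y := by
    induction S using Finset.induction_on with
    | empty => simp
    | insert j S _ ih =>
      rw [Finset.piecewise_insert, hh _ j (x j) (S.piecewise x y j), Function.update_eq_self, ih]
  simpa using key Finset.univ

/-- Operators fixed by all the `depolarize j` are multiples of the identity. -/
lemma eq_smul_of_depolarize_eq (g : EuclideanSpace ℂ (Qubits n × Qubits n))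
    (hg : ∀ j, depolarize j g = g) : ∃ c : ℂ, g = c • vectorize 1 := by
  have hg' (j : Fin n) (x y : Qubits n) := (depolarize_apply j g x y).symm.trans (by rw [hg j])
  refine ⟨g (0, 0), ?_⟩
  ext ⟨x, y⟩
  rw [PiLp.smul_apply, vectorize_apply, Matrix.one_apply]
  by_cases hxy : x = y
  · subst hxy
    rw [if_pos rfl, smul_eq_mul, mul_one]
    refine eq_of_update_invariant (fun x => g (x, x)) (fun x j s t => ?_) x 0
    simp only
    rw [← hg' j (Function.update x j s), ← hg' j (Function.update x j t)]
    simp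
  · obtain ⟨j, hj⟩ := Function.ne_iff.1 hxy
    rw [if_neg hxy, smul_zero, ← hg' j, if_neg hj]

/-- Such a `g` is a scalar operator: the equality case of Cauchy–Schwarz against the identity. -/
lemma sq_norm_trace_eq_of_depolarize_eq (g : EuclideanSpace ℂ (Qubits n × Qubits n))
    (hg : ∀ j, depolarize j g = g) : 2 ^ n * ‖g‖ ^ 2 = ‖∑ x, g (x, x)‖ ^ 2 := by
  obtain ⟨c, rfl⟩ := eq_smul_of_depolarize_eq g hg
  rw [← inner_vectorize_one, inner_smul_right, inner_self_eq_norm_sq_to_K, norm_smul, norm_mul,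
    mul_pow, mul_pow, norm_vectorize_sq (one_mem _)]
  have h := norm_vectorize_sq (n := n) (one_mem _)
  rw [norm_pow, RCLike.norm_ofReal, abs_of_nonneg (norm_nonneg _), h]
  ring

lemma mul_placeAt_single_apply (W : Matrix (Qubits n) (Qubits n) ℂ) (j : Fin n) (a b c : Fin 2)
    (x : Qubits n) (w : OtherQubits j) :
    (W * placeAt j (Matrix.single b a 1) (maxMixedOthers j)) x ((splitQubit j).symm (c, w))
      = if a = c then 1 / 2 ^ (n - 1) * W x ((splitQubit j).symm (b, w)) else 0 := by
  rw [Matrix.mul_apply, ← (splitQubit j).symm.sum_comp, Fintype.sum_prod_type,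
    Finset.sum_eq_single b, Finset.sum_eq_single w]
  · simp [placeAt, Matrix.single_apply, maxMixedOthers, mul_comm]
  · intro u _ hu
    simp [placeAt, maxMixedOthers, Matrix.one_apply_ne hu]
  · simp
  · intro d _ hd
    simp [placeAt, hd.symm]
  · simp

lemma localChannel_single_apply (U V : Matrix (Qubits n) (Qubits n) ℂ) (j : Fin n) (a b : Fin 2) :
    localChannel U V j (Matrix.single b a 1) b a
      = 1 / 2 ^ (n - 1) * ∑ z : OtherQubits j, ∑ w : OtherQubits j,
        (U * Vᴴ) ((splitQubit j).symm (b, z)) ((splitQubit j).symm (b, w)) *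
          star ((U * Vᴴ) ((splitQubit j).symm (a, z)) ((splitQubit j).symm (a, w))) := by
  have hW : V * Uᴴ = (U * Vᴴ)ᴴ := by simp
  change traceOthers j (U * Vᴴ * placeAt j _ (maxMixedOthers j) * (V * Uᴴ)) b a = _
  rw [hW]
  generalize U * Vᴴ = W
  rw [traceOthers, Matrix.of_apply, Finset.mul_sum]
  refine Finset.sum_congr rfl fun z _ => ?_
  rw [Matrix.mul_apply, ← (splitQubit j).symm.sum_comp, Fintype.sum_prod_type_right, Finset.mul_sum]
  refine Finset.sum_congr rfl fun w _ => ?_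
  simp only [mul_placeAt_single_apply, Matrix.conjTranspose_apply, ite_mul, zero_mul,
    Finset.sum_ite_eq, Finset.mem_univ, if_true]
  ring

lemma bellProj_apply (p q : Fin 2 × Fin 2) :
    bellProj p q = if p.1 = p.2 ∧ q.1 = q.2 then 1 / 2 else 0 := by
  have h : (Real.sqrt 2 : ℂ) * Real.sqrt 2 = 2 := by
    rw [← Complex.ofReal_mul, Real.mul_self_sqrt zero_le_two, Complex.ofReal_ofNat]
  rw [bellProj, Matrix.vecMulVec_apply, Pi.star_apply, bellVec, bellVec]
  by_cases hp : p.1 = p.2 <;> by_cases hq : q.1 = q.2 <;> simp [hp, hq]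
  rw [← mul_inv, h]

/-- Each Bell projector contributes a factor `1/2`, and its slices are halved matrix units, so only
the values of `Φ` on matrix units enter. -/
lemma trace_bellProj_mul_tensorId (Φ : Matrix (Fin 2) (Fin 2) ℂ →ₗ[ℂ] Matrix (Fin 2) (Fin 2) ℂ) :
    (bellProj * tensorId Φ bellProj).trace
      = 1 / 4 * ∑ a, ∑ b, Φ (Matrix.single b a 1) b a := by
  have hX (p q : Fin 2 × Fin 2) : tensorId Φ bellProj p q
      = 1 / 2 * Φ (Matrix.single p.2 q.2 1) p.1 q.1 := by
    have h : (Matrix.of fun c c' => bellProj (c, p.2) (c', q.2))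
        = (1 / 2 : ℂ) • Matrix.single p.2 q.2 1 := by
      ext c c'
      simp [bellProj_apply, Matrix.single_apply, eq_comm]
    rw [tensorId, Matrix.of_apply, h, map_smul, Matrix.smul_apply, smul_eq_mul]
  simp only [Matrix.trace, Matrix.diag_apply, Matrix.mul_apply, hX, bellProj_apply,
    Fintype.sum_prod_type, Fin.sum_univ_two]
  simp
  ring

lemma entFidelity_eq (hn : 1 ≤ n) (U V : Matrix (Qubits n) (Qubits n) ℂ) (j : Fin n) :
    entFidelity U V j = ‖depolarize j (vectorize (U * Vᴴ))‖ ^ 2 / 2 ^ n := by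
  -- Removes the truncated subtraction in `2 ^ (n - 1)`; the constants then match as `1/4 · 1/2^m =
  -- 1/2^(m+1) · 1/2`.
  obtain ⟨m, rfl⟩ := Nat.exists_eq_add_of_le' hn
  have h : (bellProj * tensorId (localChannel U V j) bellProj).trace
      = ((1 / 2 ^ (m + 1) : ℝ) : ℂ) *
        inner ℂ (vectorize (U * Vᴴ)) (depolarize j (vectorize (U * Vᴴ))) := by
    rw [trace_bellProj_mul_tensorId, inner_depolarize]
    simp only [localChannel_single_apply, vectorize_apply, Fin.sum_univ_two, Finset.mul_sum,
      ← Finset.sum_add_distrib]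
    refine Finset.sum_congr rfl fun z _ => Finset.sum_congr rfl fun w _ => ?_
    rw [star_add]
    push_cast
    rw [pow_succ]
    field_simp
    ring
  rw [(isSymmetricProjection_depolarize j).norm_apply_sq, entFidelity, h, Complex.re_ofReal_mul]
  ring

lemma mul_costLHST_eq (hn : 1 ≤ n) (U V : Matrix (Qubits n) (Qubits n) ℂ) :
    (n : ℝ) * costLHST U V = ∑ j, (1 - entFidelity U V j) := by
  have : (n : ℝ) ≠ 0 := by positivity
  rw [costLHST, Finset.sum_sub_distrib]
  simp
  field_simp

lemma costHST_qubits (U V : Matrix (Qubits n) (Qubits n) ℂ) :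
    costHST U V = 1 - ‖∑ x, vectorize (U * Vᴴ) (x, x)‖ ^ 2 / 2 ^ n / 2 ^ n := by
  have h : (Fintype.card (Qubits n) : ℝ) = 2 ^ n := by simp
  rw [costHST, h, div_div, ← sq, one_div_mul_eq_div]
  rfl

/-- Since `P_j` fixes the identity, `Tr W = ⟨1, P_j W⟩`, and Cauchy–Schwarz applies. -/
lemma one_sub_entFidelity_le_costHST (hn : 1 ≤ n) (U V : Matrix (Qubits n) (Qubits n) ℂ)
    (j : Fin n) : 1 - entFidelity U V j ≤ costHST U V := by
  rw [entFidelity_eq hn, costHST_qubits]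
  gcongr
  rw [div_le_iff₀ (by positivity), ← inner_vectorize_one, ← depolarize_vectorize_one j,
    (isSymmetricProjection_depolarize j).isSymmetric]
  have h := pow_le_pow_left₀ (norm_nonneg _) (norm_inner_le_norm (𝕜 := ℂ) (vectorize (n := n) 1)
    (depolarize j (vectorize (U * Vᴴ)))) 2
  rwa [mul_pow, norm_vectorize_sq (one_mem _), mul_comm] at h

lemma costLHST_le_costHST (hn : 1 ≤ n) (U V : Matrix (Qubits n) (Qubits n) ℂ) :
    costLHST U V ≤ costHST U V := by
  have h : (n : ℝ) * costLHST U V ≤ n * costHST U V := by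
    rw [mul_costLHST_eq hn]
    refine (Finset.sum_le_sum fun j _ => one_sub_entFidelity_le_costHST hn U V j).trans ?_
    simp
  exact le_of_mul_le_mul_left h (by positivity)

lemma costHST_le_mul_costLHST (hn : 1 ≤ n) {U V : Matrix (Qubits n) (Qubits n) ℂ}
    (hU : U ∈ Matrix.unitaryGroup (Qubits n) ℂ) (hV : V ∈ Matrix.unitaryGroup (Qubits n) ℂ) :
    costHST U V ≤ (n : ℝ) * costLHST U V := by
  have hW : ‖vectorize (U * Vᴴ)‖ ^ 2 = 2 ^ n :=
    norm_vectorize_sq (mul_mem hU (Unitary.star_mem hV))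
  set f := vectorize (U * Vᴴ) with hf
  -- The scalar part of `W`: it is fixed by every `P_j` and has the same trace as `W`.
  set g := ((List.finRange n).map depolarize).prod f with hg
  have hP := isSymmetricProjection_depolarize (n := n)
  have h1 := norm_sq_sub_norm_prod_sq_le_sum depolarize hP depolarize_commute (List.finRange n) f
  have h2 := sq_norm_trace_eq_of_depolarize_eq g fun j =>
    apply_prod_apply depolarize hP depolarize_commute _ (List.mem_finRange j) f
  have h3 : ∑ x, g (x, x) = ∑ x, f (x, x) := by
    rw [← inner_vectorize_one, ← inner_vectorize_one, hg,
      inner_prod_apply depolarize hP _ _ depolarize_vectorize_one]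
  rw [← hg, ← List.ofFn_eq_map, List.sum_ofFn, hW] at h1
  rw [h3] at h2
  rw [mul_costLHST_eq hn, costHST_qubits, ← hf, ← h2]
  have h4 (j : Fin n) : 1 - entFidelity U V j = (2 ^ n - ‖depolarize j f‖ ^ 2) / 2 ^ n := by
    rw [entFidelity_eq hn, sub_div, div_self (by positivity)]
  simp only [h4]
  rw [← Finset.sum_div, mul_div_cancel_left₀ _ (by positivity), le_div_iff₀ (by positivity), sub_mul,
    one_mul, div_mul_cancel₀ _ (by positivity)]
  exact h1

end LocalCost

/-! ### Small costs and the final assembly -/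

/-- With `s = √(1 - x) ≥ 1 - x`, one has `2(1 - s) = 2x/(1 + s) ≤ 2x/(2 - x)`, and the threshold on
`x` makes `2/(2 - x) ≤ 1 + ε`. -/
lemma two_mul_one_sub_sqrt_one_sub_le {ε x : ℝ} (hε : 0 < ε) (h0 : 0 ≤ x)
    (hx : x ≤ ε / (1 + ε)) : 2 * (1 - Real.sqrt (1 - x)) ≤ (1 + ε) * x := by
  rw [le_div_iff₀ (by positivity)] at hx
  have hx1 : x ≤ 1 := by nlinarith
  have hs := Real.sq_sqrt (sub_nonneg.2 hx1)
  have hs0 := Real.sqrt_nonneg (1 - x)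
  have hle : 1 - x ≤ Real.sqrt (1 - x) := Real.le_sqrt_of_sq_le (by nlinarith)
  nlinarith [mul_nonneg h0 hε.le]

lemma costLHST_pow_le {n : ℕ} (hn : 1 ≤ n) {U V : Matrix (Qubits n) (Qubits n) ℂ}
    (hU : U ∈ Matrix.unitaryGroup (Qubits n) ℂ) (hV : V ∈ Matrix.unitaryGroup (Qubits n) ℂ)
    (N : ℕ) : costLHST (U ^ N) (V ^ N)
      ≤ 2 * ((N : ℝ) ^ 2 * (1 - Real.sqrt (1 - n * costLHST U V))) := by
  refine (costLHST_le_costHST hn _ _).trans ?_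
  have h1 := one_sub_sqrt_costHST_pow_le hU hV N
  have h2 : (N : ℝ) ^ 2 * (1 - Real.sqrt (1 - costHST U V))
      ≤ (N : ℝ) ^ 2 * (1 - Real.sqrt (1 - n * costLHST U V)) := by
    gcongr
    exact costHST_le_mul_costLHST hn hU hV
  have h3 := Real.sq_sqrt (sub_nonneg.2 (costHST_le_one (U ^ N) (V ^ N)))
  -- With `s = √(1 - C)`, `2(1 - s) - C = (1 - s)²`.
  nlinarith [sq_nonneg (1 - Real.sqrt (1 - costHST (U ^ N) (V ^ N)))]

theorem mainTheorem3 :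
    -- the phase-minimised distance and the bound for the global cost, in any dimension
    (∀ (ι : Type) [Fintype ι] [DecidableEq ι] [Nonempty ι] (U₁ U₂ : Matrix ι ι ℂ),
      U₁ ∈ Matrix.unitaryGroup ι ℂ → U₂ ∈ Matrix.unitaryGroup ι ℂ →
        IsLeast (Set.range (phaseDist U₁ U₂)) (epsTilde U₁ U₂) ∧
        epsTilde U₁ U₂
          = Real.sqrt (2 * (Fintype.card ι : ℝ) * (1 - Real.sqrt (1 - costHST U₁ U₂))) ∧
        ∀ N : ℕ, 1 ≤ N →
          1 - Real.sqrt (1 - costHST (U₁ ^ N) (U₂ ^ N))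
            ≤ (N : ℝ) ^ 2 * (1 - Real.sqrt (1 - costHST U₁ U₂))) ∧
    -- the comparison of the two costs and the bound for the local cost, on `n` qubits
    (∀ (n : ℕ), 1 ≤ n → ∀ U V : Matrix (Qubits n) (Qubits n) ℂ,
      U ∈ Matrix.unitaryGroup (Qubits n) ℂ → V ∈ Matrix.unitaryGroup (Qubits n) ℂ →
        costLHST U V ≤ costHST U V ∧
        costHST U V ≤ (n : ℝ) * costLHST U V ∧
        ∀ N : ℕ, 1 ≤ N → (n : ℝ) * costLHST U V ≤ 1 →
          1 - Real.sqrt (1 - costLHST (U ^ N) (V ^ N))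
            ≤ (N : ℝ) ^ 2 * (1 - Real.sqrt (1 - (n : ℝ) * costLHST U V))) ∧
    -- the approximate bound for small cost: the relative error tends to zero with `n * costLHST`
    (∀ ε : ℝ, 0 < ε → ∃ δ : ℝ, 0 < δ ∧
      ∀ (n : ℕ), 1 ≤ n → ∀ U V : Matrix (Qubits n) (Qubits n) ℂ,
        U ∈ Matrix.unitaryGroup (Qubits n) ℂ → V ∈ Matrix.unitaryGroup (Qubits n) ℂ →
          ∀ N : ℕ, 1 ≤ N → (n : ℝ) * costLHST U V ≤ δ →
            costLHST (U ^ N) (V ^ N) ≤ (1 + ε) * ((n : ℝ) * (N : ℝ) ^ 2 * costLHST U V)) := by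
  refine ⟨fun ι _ _ _ U V hU hV => ?_, fun n hn U V hU hV => ?_, fun ε hε => ?_⟩
  · obtain ⟨h1, h2⟩ := epsTilde_isLeast_and_eq hU hV
    exact ⟨h1, h2, fun N _ => one_sub_sqrt_costHST_pow_le hU hV N⟩
  · refine ⟨costLHST_le_costHST hn U V, costHST_le_mul_costLHST hn hU hV, fun N _ _ => ?_⟩
    calc 1 - Real.sqrt (1 - costLHST (U ^ N) (V ^ N))
        ≤ 1 - Real.sqrt (1 - costHST (U ^ N) (V ^ N)) := by
          gcongr
          exact costLHST_le_costHST hn _ _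
      _ ≤ (N : ℝ) ^ 2 * (1 - Real.sqrt (1 - costHST U V)) := one_sub_sqrt_costHST_pow_le hU hV N
      _ ≤ (N : ℝ) ^ 2 * (1 - Real.sqrt (1 - (n : ℝ) * costLHST U V)) := by
          gcongr
          exact costHST_le_mul_costLHST hn hU hV
  -- The scalar estimate is applied to `x = n C_LHST` itself, so `δ` depends on `ε` alone.
  · refine ⟨ε / (1 + ε), by positivity, fun n hn U V hU hV N _ hδ => ?_⟩
    have h0 := (costHST_nonneg hU hV).trans (costHST_le_mul_costLHST hn hU hV)
    have h1 := mul_le_mul_of_nonneg_left (two_mul_one_sub_sqrt_one_sub_le hε h0 hδ)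
      (sq_nonneg (N : ℝ))
    linarith [costLHST_pow_le hn hU hV N]
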